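/- Let $X$ be a vector space over $\mathbb K\in\{\mathbb R,\mathbb C\}$, and let $S$ and $T$ be linear operators in $X$ defined on linear subspaces $\operatorname{dom}S$ and $\operatorname{dom}T$ of $X$. Assume that there is a linear subspace $M\subseteq\operatorname{dom}S\cap\operatorname{dom}T$ on which $S$ and $T$ coincide and such that $$\max\{\dim(\operatorname{dom}S/M),\ \dim(\operatorname{dom}T/M)\}=k<\infty .$$ For an operator $A$ in $X$ and $\lambda\in\mathbb K$ let $\mathcal L_\lambda(A)=\bigcup_{j\ge 1}\ker(A-\lambda)^j$ be the root subspace of $A$ at $\lambda$, where the powers have their natural domains. A Jordan chain of $A$ at $\lambda$ of length $n\ge 1$ is a finite sequence $x_0,\dots,x_{n-1}$ of nonzero vectors in $\operatorname{dom}A$ with $(A-\lambda)x_0=0$ and $(A-\lambda)x_i=x_{i-1}$ for $1\le i\le n-1$. Let $\lambda\in\mathbb K$, assume that $\mathcal L_\lambda(S)$ is finite dimensional, and let $n_1\ge n_2\ge\dots\ge n_l$ be the lengths of the linearly independent Jordan chains of $S$ at $\lambda$, that is, the lengths of $l$ Jordan chains of $S$ at $\lambda$ whose elements together form a basis of $\mathcal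 L_\lambda(S)$. If $k\le l$, then $$\dim\mathcal L_\lambda(S)-(n_1+\dots+n_k)\ \le\ \dim\mathcal L_\lambda(T),$$ where the right-hand side may be infinite. -/

import Mathlib

namespace LinearPMap

variable {K X : Type*} [RCLike K] [AddCommGroup X] [Module K X]

/-- The operator `S - lam`, defined on `dom S`. -/
def subScalar (S : X →ₗ.[K] X) (lam : K) : X →ₗ.[K] X where
  domain := S.domain
  toFun := S.toFun - lam • S.domain.subtype

theorem subScalar_apply (S : X →ₗ.[K] X) (lam : K) (x : S.domain) :
    S.subScalar lam x = S x - lam • (x : X) := rfl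

/-- The product `B A` of two operators with its natural domain
`{x ∈ dom A : A x ∈ dom B}`. -/
def natComp (B A : X →ₗ.[K] X) : X →ₗ.[K] X where
  domain :=
    { carrier := {x | ∃ h : x ∈ A.domain, A ⟨x, h⟩ ∈ B.domain}
      add_mem' := by
        rintro x y ⟨hx, hx'⟩ ⟨hy, hy'⟩
        refine ⟨A.domain.add_mem hx hy, ?_⟩
        have := A.map_add ⟨x, hx⟩ ⟨y, hy⟩
        rw [AddMemClass.mk_add_mk] at this
        rw [this]
        exact B.domain.add_mem hx' hy'
      zero_mem' := ⟨A.domain.zero_mem, by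
        have : A ⟨0, A.domain.zero_mem⟩ = 0 := A.map_zero
        rw [this]
        exact B.domain.zero_mem⟩
      smul_mem' := by
        rintro c x ⟨hx, hx'⟩
        refine ⟨A.domain.smul_mem c hx, ?_⟩
        have := A.map_smul c ⟨x, hx⟩
        rw [SetLike.mk_smul_mk] at this
        rw [this]
        exact B.domain.smul_mem c hx' }
  toFun :=
    { toFun := fun x => B ⟨A ⟨x, x.2.fst⟩, x.2.snd⟩
      map_add' := by
        intro x y
        rw [← B.map_add]
        congr 1
        exact Subtype.ext (A.map_add ⟨x, x.2.fst⟩ ⟨y, y.2.fst⟩)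
      map_smul' := by
        intro c x
        rw [RingHom.id_apply, ← B.map_smul]
        congr 1
        exact Subtype.ext (A.map_smul c ⟨x, x.2.fst⟩) }

/-- The powers `A ^ j` with their natural domains; `A ^ 0` is the identity on all of `X`. -/
def natPow (A : X →ₗ.[K] X) : ℕ → (X →ₗ.[K] X)
  | 0 => LinearMap.id.toPMap ⊤
  | j + 1 => natComp (natPow A j) A

/-- The kernel `{x ∈ dom A : A x = 0}` of an operator, as a subspace of `X`. -/
def kernel (A : X →ₗ.[K] X) : Submodule K X :=
  (LinearMap.ker A.toFun).map A.domain.subtype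

theorem mem_kernel {A : X →ₗ.[K] X} {x : X} :
    x ∈ A.kernel ↔ ∃ h : x ∈ A.domain, A ⟨x, h⟩ = 0 := by
  simp [kernel]

theorem mem_kernel_natPow_succ {A : X →ₗ.[K] X} {j : ℕ} {x : X} :
    x ∈ (A.natPow (j + 1)).kernel ↔ ∃ h : x ∈ A.domain, A ⟨x, h⟩ ∈ (A.natPow j).kernel := by
  simp only [mem_kernel]
  constructor
  · rintro ⟨h, h'⟩
    exact ⟨h.fst, h.snd, h'⟩
  · rintro ⟨h, h', h''⟩
    exact ⟨⟨h, h'⟩, h''⟩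

theorem kernel_natPow_mono (A : X →ₗ.[K] X) : Monotone fun j => (A.natPow j).kernel := by
  refine monotone_nat_of_le_succ fun j => ?_
  induction j with
  | zero =>
    intro x hx
    obtain ⟨_, h⟩ := mem_kernel.1 hx
    obtain rfl : x = 0 := h
    exact zero_mem _
  | succ j ih =>
    intro x hx
    obtain ⟨h, h'⟩ := mem_kernel_natPow_succ.1 hx
    exact mem_kernel_natPow_succ.2 ⟨h, ih h'⟩

/-- The root subspace of `S` at `lam`: the union of the subspaces `ker (S - lam) ^ j`, `j ≥ 1`. -/
def rootSubspace (S : X →ₗ.[K] X) (lam : K) : Submodule K X where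
  carrier := {x | ∃ j : ℕ, 1 ≤ j ∧ x ∈ ((S.subScalar lam).natPow j).kernel}
  add_mem' := by
    rintro x y ⟨i, hi, hx⟩ ⟨j, _, hy⟩
    exact ⟨max i j, le_max_of_le_left hi,
      add_mem (kernel_natPow_mono _ (le_max_left i j) hx)
        (kernel_natPow_mono _ (le_max_right i j) hy)⟩
  zero_mem' := ⟨1, le_rfl, zero_mem _⟩
  smul_mem' := by
    rintro c x ⟨j, hj, hx⟩
    exact ⟨j, hj, Submodule.smul_mem _ c hx⟩

/-- `S` and `T` coincide on a common subspace `M` of their domains, and the larger of the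
dimensions of `dom S / M` and `dom T / M` is the natural number `k`. -/
def IsFiniteRankPerturbation (S T : X →ₗ.[K] X) (k : ℕ) : Prop :=
  ∃ M : Submodule K X, M ≤ S.domain ⊓ T.domain ∧
    (∀ (x : X) (hS : x ∈ S.domain) (hT : x ∈ T.domain), x ∈ M → S ⟨x, hS⟩ = T ⟨x, hT⟩) ∧
    max (Module.rank K (S.domain ⧸ M.submoduleOf S.domain))
      (Module.rank K (T.domain ⧸ M.submoduleOf T.domain)) = (k : Cardinal)

/-- `x 0, …, x (n - 1)` is a Jordan chain of length `n ≥ 1` of `S` at `lam`. -/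
structure IsJordanChain (S : X →ₗ.[K] X) (lam : K) {n : ℕ} (x : Fin n → X) : Prop where
  pos : 1 ≤ n
  ne_zero : ∀ i, x i ≠ 0
  mem_domain : ∀ i, x i ∈ S.domain
  apply_zero : ∀ i : Fin n, (i : ℕ) = 0 → S.subScalar lam ⟨x i, mem_domain i⟩ = 0
  apply_succ : ∀ i j : Fin n, (j : ℕ) = i + 1 → S.subScalar lam ⟨x j, mem_domain j⟩ = x i

/-- A complete system of linearly independent Jordan chains of `S` at `lam`: `l` Jordan chains,
the `i`-th of length `n i`, whose elements, taken together, form a basis of the root subspace. -/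
structure IsJordanSystem (S : X →ₗ.[K] X) (lam : K) {l : ℕ} {n : Fin l → ℕ}
    (x : ∀ i : Fin l, Fin (n i) → X) : Prop where
  isJordanChain : ∀ i, S.IsJordanChain lam (x i)
  linearIndependent : LinearIndependent K fun p : Σ i : Fin l, Fin (n i) => x p.1 p.2
  span_eq : Submodule.span K (Set.range fun p : Σ i : Fin l, Fin (n i) => x p.1 p.2) =
    S.rootSubspace lam

end LinearPMap

/-! Restrict `S` to `M` and call the result `R`. Since `R ≤ T`, the root subspace of `R` lies in
that of `T`, so it suffices to bound the dimension of `Q = V ⧸ P`, where `V` and `P` are the root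
subspaces of `S` and `R`. Let `N` be induced on `Q` by `S - lam`. A vector `v` of `V` is in `P` iff
`v ∈ dom R` and `(S - lam) v ∈ P`; hence `ker N` embeds in `V ⧸ (V ∩ dom R)` and has dimension at
most `k`. The images of the Jordan chains still span `Q`, though they need not stay independent. The
drop from `dim ran N ^ j` to `dim ran N ^ (j + 1)` is at most `dim ker N ≤ k`, and at most the
number of chains longer than `j`. Summing the smaller bound over `j` gives the sum of the `k`
largest lengths. -/

/-! ### Nilpotent endomorphisms spanned by chains -/

section Chains

variable {K Q : Type*} [Field K] [AddCommGroup Q] [Module K Q]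

/-- Rank-nullity for `N` restricted to `ran N ^ j`, whose kernel lies in `ker N`. -/
theorem finrank_range_pow_le_add_finrank_ker [FiniteDimensional K Q] (N : Module.End K Q) (j : ℕ) :
    Module.finrank K (LinearMap.range (N ^ j)) ≤
      Module.finrank K (LinearMap.range (N ^ (j + 1))) + Module.finrank K (LinearMap.ker N) := by
  have h := (N.domRestrict (LinearMap.range (N ^ j))).finrank_range_add_finrank_ker
  have hr : LinearMap.range (N.domRestrict (LinearMap.range (N ^ j))) =
      LinearMap.range (N ^ (j + 1)) := by
    rw [LinearMap.range_domRestrict, pow_succ', Module.End.mul_eq_comp, LinearMap.range_comp]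
  have hk : Module.finrank K (LinearMap.ker (N.domRestrict (LinearMap.range (N ^ j)))) ≤
      Module.finrank K (LinearMap.ker N) := by
    refine LinearMap.finrank_le_finrank_of_injective
      (f := ((LinearMap.range (N ^ j)).subtype ∘ₗ
        (LinearMap.ker (N.domRestrict (LinearMap.range (N ^ j)))).subtype).codRestrict
          (LinearMap.ker N) fun y => y.2) ?_
    intro a b hab
    exact Subtype.ext (Subtype.ext (congrArg (fun z : LinearMap.ker N => (z : Q)) hab))
  rw [hr] at h
  omega

variable {l : ℕ} {n : Fin l → ℕ} {N : Module.End K Q} {x : ∀ i : Fin l, Fin (n i) → Q}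

theorem pow_apply_chain
    (h0 : ∀ i (q : Fin (n i)), (q : ℕ) = 0 → N (x i q) = 0)
    (h1 : ∀ i (q r : Fin (n i)), (r : ℕ) = q + 1 → N (x i r) = x i q)
    (i : Fin l) (j : ℕ) (q : Fin (n i)) :
    (N ^ j) (x i q) = if j ≤ q then x i ⟨q - j, by omega⟩ else 0 := by
  induction j with
  | zero => simp
  | succ j ih =>
    rw [pow_succ', Module.End.mul_apply, ih]
    split_ifs with h h' h'
    · exact h1 i _ _ (by simp only; omega)
    · exact h0 i _ (by simp only; omega)
    · omega
    · exact map_zero N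

/-- In each chain longer than `j`, only the image under `N ^ j` of the top vector can be new modulo
`ran N ^ (j + 1)`. -/
theorem finrank_range_pow_le_add_card [FiniteDimensional K Q]
    (h0 : ∀ i (q : Fin (n i)), (q : ℕ) = 0 → N (x i q) = 0)
    (h1 : ∀ i (q r : Fin (n i)), (r : ℕ) = q + 1 → N (x i r) = x i q)
    (hspan : Submodule.span K (Set.range fun p : Σ i : Fin l, Fin (n i) => x p.1 p.2) = ⊤)
    (j : ℕ) :
    Module.finrank K (LinearMap.range (N ^ j)) ≤
      Module.finrank K (LinearMap.range (N ^ (j + 1))) +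
        (Finset.univ.filter fun i => j < n i).card := by
  classical
  let y : {i // i ∈ Finset.univ.filter fun i => j < n i} → Q := fun i =>
    x i ⟨n i - 1 - j, by have := (Finset.mem_filter.1 i.2).2; omega⟩
  have hle : LinearMap.range (N ^ j) ≤
      LinearMap.range (N ^ (j + 1)) ⊔ Submodule.span K (Set.range y) := by
    rw [LinearMap.range_eq_map, ← hspan, Submodule.map_span, Submodule.span_le]
    rintro _ ⟨_, ⟨⟨i, q⟩, rfl⟩, rfl⟩
    simp only [SetLike.mem_coe]
    rw [pow_apply_chain h0 h1]
    split_ifs with hq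
    · by_cases hlast : (q : ℕ) + 1 < n i
      · refine Submodule.mem_sup_left ⟨x i ⟨q + 1, hlast⟩, ?_⟩
        rw [pow_apply_chain h0 h1, if_pos (by simp only; omega)]
        congr 2
        simp only
        omega
      · refine Submodule.mem_sup_right (Submodule.subset_span
          ⟨⟨i, Finset.mem_filter.2 ⟨Finset.mem_univ _, by omega⟩⟩, ?_⟩)
        exact congrArg (x i) (Fin.ext (show n i - 1 - j = q - j by omega))
    · exact zero_mem _
  calc _ ≤ _ := Submodule.finrank_mono hle
    _ ≤ _ := Submodule.finrank_add_le_finrank_add_finrank _ _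
    _ ≤ _ := by
      gcongr
      have := finrank_range_le_card (R := K) y
      rwa [Fintype.card_coe] at this

/-- If `Q` is spanned by Jordan chains of `N` at `0` of lengths `n 0 ≥ n 1 ≥ …` and `ker N` has
dimension at most `k`, then the dimension of `Q` is at most the sum of the first `k` lengths. -/
theorem finrank_le_sum_of_span_chains [FiniteDimensional K Q] (hn : Antitone n)
    (h0 : ∀ i (q : Fin (n i)), (q : ℕ) = 0 → N (x i q) = 0)
    (h1 : ∀ i (q r : Fin (n i)), (r : ℕ) = q + 1 → N (x i r) = x i q)
    (hspan : Submodule.span K (Set.range fun p : Σ i : Fin l, Fin (n i) => x p.1 p.2) = ⊤)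
    {k : ℕ} (hk : k ≤ l) (hker : Module.finrank K (LinearMap.ker N) ≤ k) :
    Module.finrank K Q ≤ ∑ i : Fin k, n (Fin.castLE hk i) := by
  have hstep : ∀ j, Module.finrank K (LinearMap.range (N ^ j)) ≤
      Module.finrank K (LinearMap.range (N ^ (j + 1))) +
        (Finset.univ.filter fun i : Fin k => j < n (Fin.castLE hk i)).card := by
    intro j
    by_cases hall : ∀ i : Fin k, j < n (Fin.castLE hk i)
    · rw [Finset.filter_true_of_mem fun i _ => hall i, Finset.card_univ, Fintype.card_fin]
      exact (finrank_range_pow_le_add_finrank_ker N j).trans (by gcongr)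
    -- Some chain among the first `k` has length at most `j`, so by monotonicity every chain longer
    -- than `j` precedes it.
    · push Not at hall
      obtain ⟨i₀, hi₀⟩ := hall
      refine (finrank_range_pow_le_add_card h0 h1 hspan j).trans ?_
      gcongr
      refine Finset.card_le_card_of_surjOn (Fin.castLE hk) ?_
      intro i hi
      have hi' : j < n i := (Finset.mem_filter.1 hi).2
      have hlt : i < Fin.castLE hk i₀ := by
        by_contra! hc
        exact absurd (hn hc) (by omega)
      have hik : (i : ℕ) < k := lt_trans hlt i₀.2
      exact ⟨⟨i, hik⟩, Finset.mem_filter.2 ⟨Finset.mem_univ _, hi'⟩, rfl⟩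
  have hsum : ∀ J, Module.finrank K Q ≤ Module.finrank K (LinearMap.range (N ^ J)) +
      ∑ j ∈ Finset.range J,
        (Finset.univ.filter fun i : Fin k => j < n (Fin.castLE hk i)).card := by
    intro J
    induction J with
    | zero =>
      rw [pow_zero, Module.End.one_eq_id, LinearMap.range_id, finrank_top]
      exact Nat.le_add_right _ _
    | succ J ih =>
      rw [Finset.sum_range_succ]
      have := hstep J
      omega
  -- Any exponent bounding all the lengths would do.
  have hzero : N ^ (∑ i, n i) = 0 := by
    refine LinearMap.ext_on_range hspan fun p => ?_
    rw [pow_apply_chain h0 h1, if_neg, LinearMap.zero_apply]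
    have := Finset.single_le_sum (f := n) (fun i _ => Nat.zero_le _) (Finset.mem_univ p.1)
    have := p.2.2
    omega
  have h := hsum (∑ i, n i)
  rw [hzero, LinearMap.range_zero, finrank_bot, zero_add] at h
  refine h.trans ?_
  -- Double counting: chain `i` is counted once for each `j < n i`.
  simp only [Finset.card_filter]
  rw [Finset.sum_comm]
  refine Finset.sum_le_sum fun i _ => ?_
  rw [← Finset.card_filter]
  calc _ ≤ (Finset.range (n (Fin.castLE hk i))).card :=
        Finset.card_le_card fun j hj => Finset.mem_range.2 (Finset.mem_filter.1 hj).2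
    _ = _ := Finset.card_range _

end Chains

/-- By `hW`, a class in the kernel whose representative lies in `W` is zero, so the kernel embeds in
`V ⧸ W`. -/
theorem finrank_ker_mapQ_le {K V : Type*} [Field K] [AddCommGroup V] [Module K V]
    [FiniteDimensional K V] (N : Module.End K V) {P W : Submodule K V} (hP : P ≤ P.comap N)
    (hPW : P ≤ W) (hW : ∀ v ∈ W, N v ∈ P → v ∈ P) :
    Module.finrank K (LinearMap.ker (P.mapQ P N hP)) ≤ Module.finrank K (V ⧸ W) := by
  refine LinearMap.finrank_le_finrank_of_injective
    (f := Submodule.factor hPW ∘ₗ (LinearMap.ker (P.mapQ P N hP)).subtype) ?_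
  rw [← LinearMap.ker_eq_bot, LinearMap.ker_eq_bot']
  rintro ⟨v, hv⟩ h
  obtain ⟨v, rfl⟩ := Submodule.Quotient.mk_surjective P v
  have hvW : v ∈ W := (Submodule.Quotient.mk_eq_zero W).1 h
  have hvP : N v ∈ P := (Submodule.Quotient.mk_eq_zero P).1 hv
  exact Subtype.ext ((Submodule.Quotient.mk_eq_zero P).2 (hW v hvW hvP))

/-! ### Root subspaces under restriction -/

namespace LinearPMap

variable {K X : Type*} [RCLike K] [AddCommGroup X] [Module K X]

theorem mem_rootSubspace_iff {S : X →ₗ.[K] X} {lam : K} {x : X} :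
    x ∈ S.rootSubspace lam ↔
      ∃ h : x ∈ S.domain, S.subScalar lam ⟨x, h⟩ ∈ S.rootSubspace lam := by
  constructor
  · rintro ⟨j, hj, hx⟩
    obtain ⟨j, rfl⟩ := Nat.exists_eq_add_of_le' hj
    obtain ⟨h, h'⟩ := mem_kernel_natPow_succ.1 hx
    exact ⟨h, j + 1, hj, kernel_natPow_mono _ (Nat.le_succ j) h'⟩
  · rintro ⟨h, j, hj, h'⟩
    exact ⟨j + 1, by omega, mem_kernel_natPow_succ.2 ⟨h, h'⟩⟩

theorem rootSubspace_le_domain (S : X →ₗ.[K] X) (lam : K) : S.rootSubspace lam ≤ S.domain :=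
  fun _ hx => (mem_rootSubspace_iff.1 hx).1

theorem subScalar_mono {S T : X →ₗ.[K] X} (h : S ≤ T) (lam : K) :
    S.subScalar lam ≤ T.subScalar lam := by
  refine ⟨h.1, fun x y hxy => ?_⟩
  change S x - lam • (x : X) = T y - lam • (y : X)
  rw [h.2 hxy, hxy]

theorem kernel_natPow_le_of_le {A B : X →ₗ.[K] X} (h : A ≤ B) (j : ℕ) :
    (A.natPow j).kernel ≤ (B.natPow j).kernel := by
  induction j with
  | zero => exact le_rfl
  | succ j ih =>
    intro x hx
    obtain ⟨hx, hx'⟩ := mem_kernel_natPow_succ.1 hx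
    refine mem_kernel_natPow_succ.2 ⟨h.1 hx, ?_⟩
    rw [← h.2 (x := ⟨x, hx⟩) (y := ⟨x, h.1 hx⟩) rfl]
    exact ih hx'

theorem rootSubspace_mono {S T : X →ₗ.[K] X} (h : S ≤ T) (lam : K) :
    S.rootSubspace lam ≤ T.rootSubspace lam := by
  rintro x ⟨j, hj, hx⟩
  exact ⟨j, hj, kernel_natPow_le_of_le (subScalar_mono h lam) j hx⟩

/-- The endomorphism of the root subspace of `S` at `lam` induced by `S - lam`. -/
def rootEnd (S : X →ₗ.[K] X) (lam : K) : Module.End K (S.rootSubspace lam) :=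
  ((S.subScalar lam).toFun ∘ₗ Submodule.inclusion (rootSubspace_le_domain S lam)).codRestrict
    (S.rootSubspace lam) fun x => (mem_rootSubspace_iff.1 x.2).2

theorem coe_rootEnd_apply (S : X →ₗ.[K] X) (lam : K) (x : S.rootSubspace lam) :
    (S.rootEnd lam x : X) = S.subScalar lam ⟨x, rootSubspace_le_domain S lam x.2⟩ := rfl

theorem mem_rootSubspace_of_le {R S : X →ₗ.[K] X} (h : R ≤ S) {lam : K}
    (v : S.rootSubspace lam) :
    (v : X) ∈ R.rootSubspace lam ↔
      (v : X) ∈ R.domain ∧ (S.rootEnd lam v : X) ∈ R.rootSubspace lam := by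
  rw [mem_rootSubspace_iff, coe_rootEnd_apply]
  constructor
  · rintro ⟨hv, hv'⟩
    exact ⟨hv, ((subScalar_mono h lam).2 (x := ⟨v, hv⟩)
      (y := ⟨v, rootSubspace_le_domain S lam v.2⟩) rfl) ▸ hv'⟩
  · rintro ⟨hv, hv'⟩
    exact ⟨hv, ((subScalar_mono h lam).2 (x := ⟨v, hv⟩)
      (y := ⟨v, rootSubspace_le_domain S lam v.2⟩) rfl).symm ▸ hv'⟩

theorem finrank_quotient_submoduleOf_le {U D M : Submodule K X} (hUD : U ≤ D) {k : ℕ}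
    (hM : Module.rank K (D ⧸ M.submoduleOf D) ≤ k) :
    Module.finrank K (U ⧸ M.submoduleOf U) ≤ k := by
  have hfin : FiniteDimensional K (D ⧸ M.submoduleOf D) :=
    Module.rank_lt_aleph0_iff.1 (hM.trans_lt Cardinal.natCast_lt_aleph0)
  refine le_trans ?_ (Module.finrank_le_of_rank_le hM)
  refine LinearMap.finrank_le_finrank_of_injective
    (f := (M.submoduleOf U).mapQ (M.submoduleOf D) (Submodule.inclusion hUD) fun v hv => hv) ?_
  rw [← LinearMap.ker_eq_bot, LinearMap.ker_eq_bot']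
  intro v h
  obtain ⟨v, rfl⟩ := Submodule.Quotient.mk_surjective _ v
  have hv : Submodule.inclusion hUD v ∈ M.submoduleOf D := (Submodule.Quotient.mk_eq_zero _).1 h
  exact (Submodule.Quotient.mk_eq_zero _).2 hv

/-- Restricting `S` to a subspace of codimension at most `k` lowers the dimension of the root
subspace by at most the sum of the `k` largest lengths of Jordan chains. -/
theorem finrank_rootSubspace_le_of_le {R S : X →ₗ.[K] X} (hRS : R ≤ S) {k : ℕ}
    (hR : Module.rank K (S.domain ⧸ R.domain.submoduleOf S.domain) ≤ k) (lam : K)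
    [FiniteDimensional K (S.rootSubspace lam)]
    {l : ℕ} {n : Fin l → ℕ} (hn : Antitone n)
    {x : ∀ i : Fin l, Fin (n i) → X} (hx : S.IsJordanSystem lam x) (hk : k ≤ l) :
    Module.finrank K (S.rootSubspace lam) ≤
      Module.finrank K (R.rootSubspace lam) + ∑ i : Fin k, n (Fin.castLE hk i) := by
  set V := S.rootSubspace lam with hV
  let P : Submodule K V := (R.rootSubspace lam).submoduleOf V
  let W : Submodule K V := R.domain.submoduleOf V
  have hP : P ≤ P.comap (S.rootEnd lam) :=
    fun v hv => ((mem_rootSubspace_of_le hRS v).1 hv).2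
  have hPW : P ≤ W := fun v hv => ((mem_rootSubspace_of_le hRS v).1 hv).1
  have hW : ∀ v ∈ W, S.rootEnd lam v ∈ P → v ∈ P :=
    fun v h h' => (mem_rootSubspace_of_le hRS v).2 ⟨h, h'⟩
  have hmem : ∀ i q, x i q ∈ V := fun i q =>
    hx.span_eq.le (Submodule.subset_span ⟨⟨i, q⟩, rfl⟩)
  let y : ∀ i : Fin l, Fin (n i) → V := fun i q => ⟨x i q, hmem i q⟩
  have hspan : Submodule.span K (Set.range fun p : Σ i : Fin l, Fin (n i) => y p.1 p.2) = ⊤ := by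
    refine Submodule.map_injective_of_injective V.subtype_injective ?_
    rw [Submodule.map_span, ← Set.range_comp, Submodule.map_subtype_top]
    exact hx.span_eq
  have hQ : Module.finrank K (V ⧸ P) ≤ ∑ i : Fin k, n (Fin.castLE hk i) := by
    refine finrank_le_sum_of_span_chains (N := P.mapQ P (S.rootEnd lam) hP)
      (x := fun i q => P.mkQ (y i q)) hn ?_ ?_ ?_ hk
      ((finrank_ker_mapQ_le _ hP hPW hW).trans
        (finrank_quotient_submoduleOf_le (rootSubspace_le_domain S lam) hR))
    · intro i q hq
      have : S.rootEnd lam (y i q) = 0 := Subtype.ext ((hx.isJordanChain i).apply_zero q hq)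
      rw [Submodule.mkQ_apply, Submodule.mapQ_apply, this, Submodule.Quotient.mk_zero]
    · intro i q r hr
      have : S.rootEnd lam (y i r) = y i q :=
        Subtype.ext ((hx.isJordanChain i).apply_succ q r hr)
      rw [Submodule.mkQ_apply, Submodule.mapQ_apply, this, Submodule.mkQ_apply]
    · have := congrArg (Submodule.map P.mkQ) hspan
      rw [Submodule.map_span, ← Set.range_comp, Submodule.map_top, Submodule.range_mkQ] at this
      exact this
  have hPR : Module.finrank K P = Module.finrank K (R.rootSubspace lam) :=
    (Submodule.submoduleOfEquivOfLe (rootSubspace_mono hRS lam)).finrank_eq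
  have := P.finrank_quotient_add_finrank
  omega

end LinearPMap

theorem corollary2p6 {K X : Type*} [RCLike K] [AddCommGroup X] [Module K X]
    (S T : X →ₗ.[K] X) (k : ℕ) (hST : S.IsFiniteRankPerturbation T k) (lam : K)
    (hfin : FiniteDimensional K (S.rootSubspace lam))
    {l : ℕ} {n : Fin l → ℕ} (hn : Antitone n)
    (x : ∀ i : Fin l, Fin (n i) → X) (hx : S.IsJordanSystem lam x) (hk : k ≤ l) :
    Module.rank K (S.rootSubspace lam) ≤
      Module.rank K (T.rootSubspace lam) + ((∑ i : Fin k, n (Fin.castLE hk i) : ℕ) : Cardinal) := by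
  obtain ⟨M, hM, heq, hrank⟩ := hST
  have hMS : M ≤ S.domain := hM.trans inf_le_left
  have hMT : M ≤ T.domain := hM.trans inf_le_right
  let R : X →ₗ.[K] X := ⟨M, S.toFun ∘ₗ Submodule.inclusion hMS⟩
  have hRS : R ≤ S := by
    refine ⟨hMS, fun v w hvw => ?_⟩
    change S ⟨v, hMS v.2⟩ = S w
    exact congrArg S (Subtype.ext hvw)
  have hRT : R ≤ T := by
    refine ⟨hMT, fun v w hvw => ?_⟩
    change S ⟨v, hMS v.2⟩ = T w
    rw [heq v (hMS v.2) (hMT v.2) v.2]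
    exact congrArg T (Subtype.ext hvw)
  have hR := LinearPMap.finrank_rootSubspace_le_of_le hRS
    ((le_max_left _ _).trans hrank.le) lam hn hx hk
  -- Needed for `finrank` to be the true rank here, not the default `0`.
  have : FiniteDimensional K (R.rootSubspace lam) :=
    Submodule.finiteDimensional_of_le (LinearPMap.rootSubspace_mono hRS lam)
  calc Module.rank K (S.rootSubspace lam)
      = (Module.finrank K (S.rootSubspace lam) : Cardinal) := (Module.finrank_eq_rank _ _).symm
    _ ≤ (Module.finrank K (R.rootSubspace lam) : Cardinal) +
        ((∑ i : Fin k, n (Fin.castLE hk i) : ℕ) : Cardinal) := by exact_mod_cast hR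
    _ ≤ _ := by
      rw [Module.finrank_eq_rank]
      gcongr
      exact Submodule.rank_mono (LinearPMap.rootSubspace_mono hRT lam)
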